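/- Assume the Riemann hypothesis. Then there is a real number $T$ such that the following holds. Let $0<\gamma'<\gamma''$ be the ordinates of two neighboring zeros $\tfrac12+i\gamma'$ and $\tfrac12+i\gamma''$ of the Riemann zeta function on the critical line, that is, $\zeta(\tfrac12+i\gamma')=\zeta(\tfrac12+i\gamma'')=0$ and $\zeta(\tfrac12+iu)\neq 0$ for all $\gamma'<u<\gamma''$. Then for every real $t>T$ with $\gamma'<t<\gamma''$, $$\zeta''\left(\tfrac12+it\right)\neq 0,$$ where $\zeta''$ is the second derivative of $\zeta(s)$ with respect to the complex variable $s$. -/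

import Mathlib

/-- `0 < γ' < γ''` are the ordinates of two neighboring zeros `1/2 + iγ'`, `1/2 + iγ''` of the
Riemann zeta function on the critical line: both points are zeros, and there is no zero
`1/2 + iu` with `γ' < u < γ''`. -/
def AreNeighboringOrdinates (γ' γ'' : ℝ) : Prop :=
  0 < γ' ∧ γ' < γ'' ∧
    riemannZeta (1 / 2 + Complex.I * (γ' : ℂ)) = 0 ∧
    riemannZeta (1 / 2 + Complex.I * (γ'' : ℂ)) = 0 ∧
    ∀ u : ℝ, γ' < u → u < γ'' → riemannZeta (1 / 2 + Complex.I * (u : ℂ)) ≠ 0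

/-! Write `ξ = P ζ` with `P s = s (s - 1) Γ_ℝ(s)`. At a point of the critical line where `ζ ≠ 0`,
the functional equation makes `ξ'/ξ` purely imaginary and `(ξ'/ξ)'` real. Under RH moreover `(ξ'/ξ)'
≥ 0` there (Laguerre's inequality). If `ζ'' = 0`, then `L = ζ'/ζ` satisfies `L' = -L²`. Put `A = Re
P'/P`, `p = (P'/P)'` and `B = Im L`. Then `Re L = -A`, reality gives `Im p = -2AB`, and Laguerre
gives `Re p ≥ A² - B²`. High up the line `A` is large and `|p| ≤ 16 A`, so `|B| ≤ 8` and `A² ≤ 16 A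
+ 64`, which is absurd. Laguerre's inequality is obtained without a Hadamard product:
Phragmén–Lindelöf applied to `ξ(s - h) / ξ(s + h)` shows that its modulus is at most 1 right of the
critical line, and letting `h → 0` gives `Re ξ'/ξ ≥ 0` there, with equality on the line. The growth
condition needs a lower bound for `ξ`, which RH supplies through Borel–Carathéodory on zero-free
discs. The size of `A` comes from `Re ψ(u) ≥ log (Im u) - 3/2`. -/

/-! ### Lower bounds for Gamma and digamma -/

open Complex in
/-- The Beta integral is largest in absolute value on the real axis. -/
lemma norm_betaIntegral_ofReal_right_le (u : ℂ) (v : ℝ) :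
    ‖betaIntegral u v‖ ≤ (betaIntegral (u.re : ℂ) v).re := by
  have key : ∀ x ∈ Set.Ioo (0 : ℝ) 1, ∀ w : ℂ, w.re = u.re →
      ‖(x : ℂ) ^ (w - 1) * (1 - (x : ℂ)) ^ ((v : ℂ) - 1)‖ = x ^ (u.re - 1) * (1 - x) ^ (v - 1) := by
    intro x hx w hw
    rw [norm_mul, norm_cpow_eq_rpow_re_of_pos hx.1, ← ofReal_one, ← ofReal_sub,
      norm_cpow_eq_rpow_re_of_pos (by linarith [hx.2])]
    simp [hw]
  have h2 : betaIntegral (u.re : ℂ) v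
      = ((∫ x : ℝ in 0..1, x ^ (u.re - 1) * (1 - x) ^ (v - 1) : ℝ) : ℂ) := by
    rw [betaIntegral, ← intervalIntegral.integral_ofReal]
    refine intervalIntegral.integral_congr fun x hx ↦ ?_
    rw [Set.uIcc_of_le zero_le_one] at hx
    rw [ofReal_mul, ofReal_cpow hx.1, ofReal_cpow (by linarith [hx.2])]
    push_cast
    rfl
  rw [h2, ofReal_re, betaIntegral]
  refine (intervalIntegral.norm_integral_le_integral_norm zero_le_one).trans (le_of_eq ?_)
  rw [intervalIntegral.integral_of_le zero_le_one, intervalIntegral.integral_of_le zero_le_one,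
    MeasureTheory.integral_Ioc_eq_integral_Ioo, MeasureTheory.integral_Ioc_eq_integral_Ioo]
  exact MeasureTheory.setIntegral_congr_fun measurableSet_Ioo fun x hx ↦ key x hx u rfl

open Complex in
-- Compares `Γ(u) Γ(v) = Γ(u + v) B(u, v)` with the same identity at `Re u`.
lemma norm_Gamma_mul_Gamma_re_add_le {u : ℂ} {v : ℝ} (hu : 0 < u.re) (hv : 0 < v) :
    ‖Gamma u‖ * Real.Gamma (u.re + v) ≤ ‖Gamma (u + v)‖ * Real.Gamma u.re := by
  have h1 := Gamma_mul_Gamma_eq_betaIntegral hu (t := (v : ℂ)) (by simpa using hv)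
  have h2 := Gamma_mul_Gamma_eq_betaIntegral (s := (u.re : ℂ)) (t := (v : ℂ)) (by simpa using hu)
    (by simpa using hv)
  rw [← ofReal_add, Gamma_ofReal, Gamma_ofReal, Gamma_ofReal] at h2
  have h3 : Real.Gamma u.re * Real.Gamma v
      = Real.Gamma (u.re + v) * (betaIntegral (u.re : ℂ) v).re := by
    have := congrArg re h2
    simpa only [← ofReal_mul, re_ofReal_mul, ofReal_re] using this
  have h4 : ‖Gamma u‖ * Real.Gamma v = ‖Gamma (u + v)‖ * ‖betaIntegral u v‖ := by
    have := congrArg norm h1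
    rw [norm_mul, norm_mul, Gamma_ofReal, norm_real, Real.norm_of_nonneg
      (Real.Gamma_pos_of_pos hv).le] at this
    exact this
  have hGv := Real.Gamma_pos_of_pos hv
  have hGx := Real.Gamma_pos_of_pos hu
  have hGxv := Real.Gamma_pos_of_pos (add_pos hu hv)
  refine le_of_mul_le_mul_right ?_ hGv
  calc ‖Gamma u‖ * Real.Gamma (u.re + v) * Real.Gamma v
      = ‖Gamma (u + v)‖ * ‖betaIntegral u v‖ * Real.Gamma (u.re + v) := by rw [← h4]; ring
    _ ≤ ‖Gamma (u + v)‖ * (betaIntegral (u.re : ℂ) v).re * Real.Gamma (u.re + v) := by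
      gcongr
      exact norm_betaIntegral_ofReal_right_le u v
    _ = ‖Gamma (u + v)‖ * Real.Gamma u.re * Real.Gamma v := by
      rw [mul_assoc _ (Real.Gamma u.re), h3]; ring

/-- Log-convexity: the slope of `log Γ` on `[x - 1, x]` is `log (x - 1)` and cannot exceed the slope
on `[x, x + v]`. -/
lemma Real.Gamma_mul_rpow_le {x v : ℝ} (hx : 1 < x) (hv : 0 < v) :
    Real.Gamma x * (x - 1) ^ v ≤ Real.Gamma (x + v) := by
  have h := Real.convexOn_log_Gamma.slope_mono_adjacent (x := x - 1) (y := x) (z := x + v)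
    (by simp only [Set.mem_Ioi]; linarith) (by simp only [Set.mem_Ioi]; linarith)
    (by linarith) (by linarith)
  have h1 : Real.Gamma x = (x - 1) * Real.Gamma (x - 1) := by
    rw [← Real.Gamma_add_one (by linarith), sub_add_cancel]
  have hG1 := Real.Gamma_pos_of_pos (show 0 < x - 1 by linarith)
  have hG := Real.Gamma_pos_of_pos (show 0 < x by linarith)
  have hG2 := Real.Gamma_pos_of_pos (show 0 < x + v by linarith)
  have h2 : Real.log (Real.Gamma x) = Real.log (x - 1) + Real.log (Real.Gamma (x - 1)) := by
    rw [h1, Real.log_mul (by linarith) hG1.ne']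
  simp only [Function.comp_apply, h2, sub_sub_cancel, div_one, add_sub_cancel_left,
    add_sub_cancel_right] at h
  rw [le_div_iff₀ hv] at h
  rw [← Real.log_le_log_iff (by positivity) hG2, Real.log_mul hG.ne' (Real.rpow_pos_of_pos
    (by linarith) _).ne', Real.log_rpow (by linarith), h2]
  linarith

open Complex in
lemma norm_Gamma_mul_rpow_le {u : ℂ} {v : ℝ} (hu : 1 < u.re) (hv : 0 < v) :
    ‖Gamma u‖ * (u.re - 1) ^ v ≤ ‖Gamma (u + v)‖ := by
  have h1 := norm_Gamma_mul_Gamma_re_add_le (zero_lt_one.trans hu) hv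
  have h2 := Real.Gamma_mul_rpow_le hu hv
  have hG := Real.Gamma_pos_of_pos (zero_lt_one.trans hu)
  refine le_of_mul_le_mul_right (le_trans ?_ h1) hG
  calc _ = ‖Gamma u‖ * (Real.Gamma u.re * (u.re - 1) ^ v) := by ring
    _ ≤ _ := by gcongr

/-- A function bounded below by its value at `x` to the right of `x` has nonnegative derivative
at `x`. -/
lemma HasDerivAt.nonneg_of_forall_le {f : ℝ → ℝ} {f' x : ℝ} (hf : HasDerivAt f f' x)
    (h : ∀ y, x < y → f x ≤ f y) : 0 ≤ f' := by
  have ht := (hasDerivAt_iff_tendsto_slope.1 hf).mono_left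
    (nhdsWithin_mono x (fun y (hy : x < y) ↦ hy.ne') : nhdsWithin x (Set.Ioi x) ≤ _)
  refine ge_of_tendsto ht ?_
  filter_upwards [self_mem_nhdsWithin] with y hy
  rw [slope_def_field]
  exact div_nonneg (sub_nonneg.2 (h y hy)) (sub_nonneg.2 (le_of_lt hy))

open Complex ComplexConjugate in
/-- The derivative of `‖f‖ ^ 2` along a horizontal line. -/
lemma HasDerivAt.normSq_comp_add_ofReal {f : ℂ → ℂ} {f' s : ℂ} {x : ℝ}
    (hf : HasDerivAt f f' (s + x)) :
    HasDerivAt (fun y : ℝ ↦ ‖f (s + y)‖ ^ 2) (2 * (conj (f (s + x)) * f').re) x := by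
  have h1 : HasDerivAt (fun y : ℝ ↦ f (s + y)) f' x := by
    have h2 : HasDerivAt (fun w : ℂ ↦ f (s + w)) f' (x : ℂ) := by
      simpa using hf.comp_const_add s (x : ℂ)
    exact h2.comp_ofReal
  have h3 := h1.norm_sq
  convert h3 using 2
  simp [Complex.inner, mul_comm]

open Complex ComplexConjugate in
-- The function `|Γ(u + y)|² (Re u - 1)^(-2y)` is smallest at `y = 0` among `y ≥ 0`, so its
-- derivative there is nonnegative.
lemma log_le_re_digamma {u : ℂ} (hu : 1 < u.re) : Real.log (u.re - 1) ≤ (digamma u).re := by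
  have hne : ∀ m : ℕ, u ≠ -m := by
    intro m h
    have := congrArg re h
    simp at this
    have : (0 : ℝ) ≤ m := m.cast_nonneg
    linarith
  have hd : HasDerivAt Gamma (deriv Gamma u) (u + (0 : ℝ)) := by
    simpa using (differentiableAt_Gamma u hne).hasDerivAt
  have hx : 0 < u.re - 1 := by linarith
  have h1 := hd.normSq_comp_add_ofReal
  have h2 : HasDerivAt (fun y : ℝ ↦ Real.exp (-(2 * Real.log (u.re - 1)) * y))
      (Real.exp (-(2 * Real.log (u.re - 1)) * 0) * (-(2 * Real.log (u.re - 1)) * 1)) 0 :=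
    ((hasDerivAt_id (0 : ℝ)).const_mul _).exp
  have h3 := (h1.mul h2).nonneg_of_forall_le (by
    intro y hy
    have := norm_Gamma_mul_rpow_le hu hy
    rw [Real.rpow_def_of_pos hx] at this
    have h4 : (‖Gamma u‖ * Real.exp (Real.log (u.re - 1) * y)) ^ 2 ≤ ‖Gamma (u + y)‖ ^ 2 := by
      gcongr
    simp only [Pi.mul_apply, ofReal_zero, add_zero, mul_zero, Real.exp_zero, mul_one]
    rw [← div_le_iff₀ (Real.exp_pos _)]
    refine le_trans (le_of_eq ?_) h4
    rw [div_eq_mul_inv, ← Real.exp_neg, mul_pow, ← Real.exp_nat_mul]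
    congr 2
    push_cast
    ring)
  have hG : Gamma u ≠ 0 := Gamma_ne_zero hne
  have h5 : conj (Gamma u) * deriv Gamma u = (‖Gamma u‖ ^ 2 : ℝ) * digamma u := by
    rw [digamma_def, logDeriv_apply, ofReal_pow, ← conj_mul']
    field_simp
  simp only [ofReal_zero, add_zero, mul_zero, Real.exp_zero, mul_one, h5, re_ofReal_mul] at h3
  have hp : 0 < ‖Gamma u‖ ^ 2 := by positivity
  have h6 : 0 ≤ ‖Gamma u‖ ^ 2 * (2 * ((digamma u).re - Real.log (u.re - 1))) := by linarith
  have := nonneg_of_mul_nonneg_right h6 hp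
  linarith

open Complex in
lemma digamma_add_nat {u : ℂ} (hu : 0 < u.re) (N : ℕ) :
    digamma (u + N) = digamma u + ∑ j ∈ Finset.range N, (u + j)⁻¹ := by
  induction N with
  | zero => simp
  | succ N ih =>
    rw [Finset.sum_range_succ, ← add_assoc, ← ih, Nat.cast_succ, ← add_assoc,
      digamma_apply_add_one]
    intro m h
    have := congrArg re h
    simp at this
    have : (0 : ℝ) ≤ m := m.cast_nonneg
    have : (0 : ℝ) ≤ N := N.cast_nonneg
    linarith

open Complex in
lemma log_im_sub_le_re_digamma {u : ℂ} (hu : 0 < u.re) (hy : 1 ≤ u.im) :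
    Real.log u.im - 3 / 2 ≤ (digamma u).re := by
  -- Shifting by `N` makes the real part exceed `Im u + 1`. The recurrence costs `N` terms `Re (u +
  -- j)⁻¹ ≤ 1 / (2 Im u)`, in total at most `3/2` since `N ≤ Im u + 2` and `Im u ≥ 1`.
  set N := ⌊u.im⌋₊ + 2 with hN
  have hN1 : u.im + 1 ≤ N := by
    have := Nat.lt_floor_add_one u.im
    push_cast [hN]; linarith
  have hN2 : (N : ℝ) ≤ u.im + 2 := by
    have := Nat.floor_le (by linarith : 0 ≤ u.im)
    push_cast [hN]; linarith
  have h1 := log_le_re_digamma (u := u + N) (by simp; linarith)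
  have h2 : Real.log u.im ≤ Real.log ((u + N).re - 1) :=
    Real.log_le_log (by linarith) (by simp; linarith)
  have h3 := congrArg re (digamma_add_nat hu N)
  have h4 : (∑ j ∈ Finset.range N, (u + j)⁻¹).re ≤ N * (1 / (2 * u.im)) := by
    rw [re_sum]
    refine (Finset.sum_le_card_nsmul _ _ (1 / (2 * u.im)) fun j _ ↦ ?_).trans (by simp)
    rw [inv_re, normSq_apply, div_le_div_iff₀ _ (by linarith)]
    · simp only [add_re, natCast_re, add_im, natCast_im, add_zero]
      nlinarith [sq_nonneg (u.re + j - u.im)]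
    · simp only [add_re, natCast_re, add_im, natCast_im, add_zero]
      nlinarith [sq_nonneg (u.re + j)]
  have h5 : N * (1 / (2 * u.im)) ≤ 3 / 2 := by
    rw [mul_one_div, div_le_div_iff₀ (by linarith) (by norm_num)]
    linarith
  rw [add_re] at h3
  linarith

open Complex in
-- By reflection `|Γ(1/2 + iy)|² = π / |sin π(1/2 + iy)|`.
lemma exp_neg_le_norm_Gamma_half (y : ℝ) :
    Real.exp (-(Real.pi * |y|)) ≤ ‖Gamma (1 / 2 + y * I)‖ ^ 2 := by
  have h := Gamma_mul_Gamma_one_sub (1 / 2 + y * I)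
  have h1 : (1 - (1 / 2 + y * I) : ℂ) = (starRingEnd ℂ) (1 / 2 + y * I) := by
    apply Complex.ext <;> simp
    norm_num
  rw [h1, Gamma_conj, mul_conj] at h
  have h2 := congrArg norm h
  rw [norm_real, Real.norm_of_nonneg (normSq_nonneg _), normSq_eq_norm_sq, norm_div] at h2
  rw [h2]
  have h3 : ‖sin (Real.pi * (1 / 2 + y * I))‖ ≤ Real.exp (Real.pi * |y|) := by
    rw [sin, norm_div, norm_mul, norm_I, mul_one]
    have ha : ∀ w : ℂ, |w.re| ≤ Real.pi * |y| → ‖exp w‖ ≤ Real.exp (Real.pi * |y|) := by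
      intro w hw
      rw [norm_exp]
      exact Real.exp_le_exp.2 ((le_abs_self _).trans hw)
    have hb := ha (-(Real.pi * (1 / 2 + y * I)) * I) (by
      simp [abs_mul, abs_of_pos Real.pi_pos])
    have hc := ha ((Real.pi * (1 / 2 + y * I)) * I) (by
      simp [abs_mul, abs_of_pos Real.pi_pos])
    rw [norm_ofNat, div_le_iff₀ (by norm_num)]
    refine (norm_sub_le _ _).trans ?_
    linarith
  have h4 : sin (Real.pi * (1 / 2 + y * I)) ≠ 0 := by
    intro h0
    rw [h0] at h2
    simp only [norm_zero, div_zero, sq_eq_zero_iff, norm_eq_zero] at h2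
    refine Gamma_ne_zero_of_re_pos (s := 1 / 2 + y * I) (by simp) h2
  rw [norm_real, Real.norm_of_nonneg Real.pi_pos.le, Real.exp_neg, ← one_div]
  have h5 : 0 < ‖sin (Real.pi * (1 / 2 + y * I))‖ := by positivity
  gcongr
  linarith [Real.pi_gt_three]

open Complex in
lemma exists_exp_neg_le_norm_Gamma (m : ℕ) : ∃ c > 0, ∀ y : ℝ,
    c * Real.exp (-(Real.pi * |y|)) ≤ ‖Gamma (m + 1 / 2 + y * I)‖ ^ 2 := by
  induction m with
  | zero => exact ⟨1, one_pos, fun y ↦ by simpa using exp_neg_le_norm_Gamma_half y⟩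
  | succ m ih =>
    obtain ⟨c, hc, h⟩ := ih
    refine ⟨1 / 4 * c, by positivity, fun y ↦ ?_⟩
    have h0 : (m + 1 / 2 + y * I : ℂ) ≠ 0 := by
      intro h0
      have := congrArg re h0
      simp at this
      have : (0 : ℝ) ≤ m := m.cast_nonneg
      linarith
    have h1 : (((m + 1 : ℕ) : ℂ) + 1 / 2 + y * I) = (m + 1 / 2 + y * I) + 1 := by
      push_cast; ring
    rw [h1, Gamma_add_one _ h0, norm_mul, mul_pow, mul_assoc]
    refine mul_le_mul ?_ (h y) (by positivity) (by positivity)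
    have h2 := abs_re_le_norm (m + 1 / 2 + y * I)
    simp only [add_re, natCast_re, mul_re, ofReal_re, I_re, mul_zero, ofReal_im, I_im, mul_one,
      sub_self, add_zero, one_div] at h2
    have : (0 : ℝ) ≤ m := m.cast_nonneg
    rw [abs_of_nonneg (by norm_num; linarith)] at h2
    norm_num at h2 ⊢
    nlinarith

/-! ### Consequences of Borel–Carathéodory on discs -/

open Complex Metric in
/-- A zero-free holomorphic function on a disc has a holomorphic logarithm. -/
lemma exists_eq_mul_exp_on_ball {f : ℂ → ℂ} {c : ℂ} {R : ℝ}
    (hf : DifferentiableOn ℂ f (ball c R)) (h0 : ∀ z ∈ ball c R, f z ≠ 0) :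
    ∃ g : ℂ → ℂ, DifferentiableOn ℂ g (ball c R) ∧ g c = 0 ∧
      ∀ z ∈ ball c R, f z = f c * exp (g z) := by
  rcases le_or_gt R 0 with hR | hR
  · exact ⟨fun _ ↦ 0, by fun_prop, rfl, by simp [ball_eq_empty.2 hR]⟩
  obtain ⟨g, hg⟩ := ((hf.deriv isOpen_ball).div hf h0).isExactOn_ball
  have hgd : DifferentiableOn ℂ g (ball c R) :=
    fun z hz ↦ (hg z hz).differentiableAt.differentiableWithinAt
  have hd : ∀ z ∈ ball c R, HasDerivAt (fun z ↦ f z * exp (-(g z - g c))) 0 z := by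
    intro z hz
    have h1 := (hf.differentiableAt (isOpen_ball.mem_nhds hz)).hasDerivAt
    convert! h1.mul (((hg z hz).sub_const (g c)).neg.cexp) using 1
    simp only [Pi.div_apply]
    field_simp [h0 z hz]
    ring
  refine ⟨fun z ↦ g z - g c, hgd.sub_const _, sub_self _, fun z hz ↦ ?_⟩
  have h2 := isOpen_ball.is_const_of_deriv_eq_zero (convex_ball c R).isPreconnected
    (fun z hz ↦ (hd z hz).differentiableAt.differentiableWithinAt) (fun z hz ↦ (hd z hz).deriv)
    hz (mem_ball_self hR)
  simp only [sub_self, neg_zero, exp_zero, mul_one] at h2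
  rw [← h2, mul_assoc, ← exp_add, neg_add_cancel, exp_zero, mul_one]

open Complex Metric in
/-- A zero-free holomorphic function that is not much larger than its value at the centre of a
disc is not much smaller either. -/
lemma norm_center_mul_exp_neg_le {f : ℂ → ℂ} {c z : ℂ} {R r M : ℝ}
    (hf : DifferentiableOn ℂ f (ball c R)) (h0 : ∀ z ∈ ball c R, f z ≠ 0) (hM : 0 < M)
    (hb : ∀ z ∈ ball c R, ‖f z‖ ≤ ‖f c‖ * Real.exp M) (hz : ‖z - c‖ ≤ r) (hr : r < R) :
    ‖f c‖ * Real.exp (-(2 * M * r / (R - r))) ≤ ‖f z‖ := by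
  have hR : 0 < R := ((norm_nonneg _).trans hz).trans_lt hr
  obtain ⟨g, hg, hgc, hfg⟩ := exists_eq_mul_exp_on_ball hf h0
  have hcc : 0 < ‖f c‖ := norm_pos_iff.2 (h0 c (mem_ball_self hR))
  have hmap : Set.MapsTo (fun w ↦ c + w) (ball 0 R) (ball c R) := fun w hw ↦ by
    simpa [mem_ball, dist_eq_norm] using hw
  have hzb : z ∈ ball c R := by rw [mem_ball, dist_eq_norm]; linarith
  have h1 := borelCaratheodory_zero (f := fun w ↦ g (c + w)) (z := z - c) hM
    (hg.comp (by fun_prop) hmap) (fun w hw ↦ by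
      have h2 := hb _ (hmap hw)
      rw [hfg _ (hmap hw), norm_mul, norm_exp] at h2
      exact Real.exp_le_exp.1 (le_of_mul_le_mul_left h2 hcc)) hR
    (by rw [mem_ball, dist_zero_right]; linarith) (by simpa using hgc)
  simp only [add_sub_cancel] at h1
  rw [hfg z hzb, norm_mul, norm_exp]
  have h3 : 2 * M * ‖z - c‖ / (R - ‖z - c‖) ≤ 2 * M * r / (R - r) := by
    have : 0 < R - r := by linarith
    gcongr
    nlinarith [norm_nonneg (z - c)]
  have h4 := (abs_le.1 (abs_re_le_norm (g z))).1
  gcongr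
  linarith

open Complex Metric in
lemma norm_deriv_le_of_re_nonneg {f : ℂ → ℂ} {c : ℂ} {R : ℝ} (hR : 0 < R)
    (hf : DifferentiableOn ℂ f (ball c R)) (hre : ∀ z ∈ ball c R, 0 ≤ (f z).re)
    (hc : 0 < (f c).re) : ‖deriv f c‖ ≤ 4 * (f c).re / R := by
  have hmap : Set.MapsTo (fun w ↦ c + w) (ball 0 R) (ball c R) := fun w hw ↦ by
    simpa [mem_ball, dist_eq_norm] using hw
  -- `f c - f` vanishes at `c` and has real part at most `Re f(c)`; Cauchy's estimate at radius `R /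
  -- 2` then gives the factor 4.
  have hb : ∀ z ∈ sphere c (R / 2), ‖f c - f z‖ ≤ 2 * (f c).re := by
    intro z hz
    rw [mem_sphere, dist_eq_norm] at hz
    have h1 := borelCaratheodory_zero (f := fun w ↦ f c - f (c + w)) (z := z - c) hc
      ((hf.comp (by fun_prop) hmap).const_sub _) (fun w hw ↦ by
        have := hre _ (hmap hw)
        simpa using this) hR
      (by rw [mem_ball, dist_zero_right]; linarith) (by simp)
    simp only [add_sub_cancel, hz] at h1
    refine h1.trans (le_of_eq ?_)
    field_simp
    norm_num
  have hd : DiffContOnCl ℂ (fun z ↦ f c - f z) (ball c (R / 2)) := by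
    refine DifferentiableOn.diffContOnCl ((hf.const_sub _).mono ?_)
    exact closure_ball_subset_closedBall.trans (closedBall_subset_ball (by linarith))
  have h2 := norm_deriv_le_of_forall_mem_sphere_norm_le (by linarith) hd hb
  rw [deriv_const_sub, norm_neg] at h2
  refine h2.trans (le_of_eq ?_)
  field_simp
  norm_num

/-! ### The function `ξ`: symmetries and growth in vertical strips -/

/-- The Riemann `ξ`-function `s (s - 1) Λ(s)`, without the customary factor `1 / 2`. -/
noncomputable def riemannXi (s : ℂ) : ℂ := s * (s - 1) * completedRiemannZeta₀ s + 1

lemma differentiable_riemannXi : Differentiable ℂ riemannXi := by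
  have := differentiable_completedZeta₀
  unfold riemannXi
  fun_prop

lemma riemannXi_one_sub (s : ℂ) : riemannXi (1 - s) = riemannXi s := by
  rw [riemannXi, riemannXi, completedRiemannZeta₀_one_sub]
  ring

/-- The polar terms `-1/s - 1/(1 - s)` of `Λ`, multiplied by `s (s - 1)`, give the constant 1 in
`riemannXi`. -/
lemma riemannXi_eq {s : ℂ} (h0 : s ≠ 0) (h1 : s ≠ 1) :
    riemannXi s = s * (s - 1) * completedRiemannZeta s := by
  have h2 : 1 - s ≠ 0 := sub_ne_zero.2 h1.symm
  rw [completedRiemannZeta_eq, riemannXi]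
  field_simp
  ring

lemma riemannXi_eq_Gammaℝ_mul {s : ℂ} (h0 : 0 < s.re) (h1 : s ≠ 1) :
    riemannXi s = s * (s - 1) * Complex.Gammaℝ s * riemannZeta s := by
  have hs : s ≠ 0 := by rintro rfl; simp at h0
  rw [riemannXi_eq hs h1, riemannZeta_def_of_ne_zero hs]
  field_simp [Complex.Gammaℝ_ne_zero_of_re_pos h0]

lemma RiemannHypothesis.riemannXi_ne_zero (h : RiemannHypothesis) {s : ℂ} (hs : 1 / 2 < s.re) :
    riemannXi s ≠ 0 := by
  rcases eq_or_ne s 1 with rfl | h1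
  · simp [riemannXi]
  have h0 : s ≠ 0 := by rintro rfl; norm_num at hs
  have hp : 0 < s.re := by linarith
  rw [riemannXi_eq_Gammaℝ_mul hp h1]
  refine mul_ne_zero (mul_ne_zero (mul_ne_zero h0 (sub_ne_zero.2 h1))
    (Complex.Gammaℝ_ne_zero_of_re_pos hp)) fun hz ↦ ?_
  refine hs.ne' (h s hz ?_ h1)
  rintro ⟨n, rfl⟩
  simp at hp
  have : (0 : ℝ) ≤ n := n.cast_nonneg
  linarith

/-- `Λ₀` as a Mellin transform of a real-valued function. -/
lemma exists_completedRiemannZeta₀_eq_mellin : ∃ f : ℝ → ℝ,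
    (∀ s : ℂ, MellinConvergent (fun x ↦ (f x : ℂ)) s) ∧
      ∀ s : ℂ, completedRiemannZeta₀ s = mellin (fun x ↦ (f x : ℂ)) (s / 2) / 2 := by
  set P := HurwitzZeta.hurwitzEvenFEPair 0
  have hf : ∀ x, ((P.f_modif x).re : ℂ) = P.f_modif x := by
    intro x
    rw [← Complex.conj_eq_iff_re]
    simp only [P, WeakFEPair.f_modif, HurwitzZeta.hurwitzEvenFEPair, Pi.add_apply, Set.indicator]
    split_ifs <;> simp
  refine ⟨fun x ↦ (P.f_modif x).re, fun s ↦ ?_, fun s ↦ ?_⟩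
  · simp only [hf]
    exact (P.isStrongFEPair_toStrongFEPair.hasMellin s).1
  · simp only [hf]
    rfl

open ComplexConjugate in
lemma mellin_ofReal_conj (f : ℝ → ℝ) (s : ℂ) :
    mellin (fun x ↦ (f x : ℂ)) (conj s) = conj (mellin (fun x ↦ (f x : ℂ)) s) := by
  rw [mellin, mellin, ← integral_conj]
  refine MeasureTheory.setIntegral_congr_fun measurableSet_Ioi fun x (hx : 0 < x) ↦ ?_
  have h := Complex.cpow_conj (x : ℂ) (s - 1) (by
    rw [Complex.arg_ofReal_of_nonneg hx.le]; exact Real.pi_ne_zero.symm)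
  simp only [map_sub, map_one, Complex.conj_ofReal] at h
  simp [h]

open ComplexConjugate in
lemma riemannXi_conj (s : ℂ) : riemannXi (conj s) = conj (riemannXi s) := by
  obtain ⟨f, -, hf⟩ := exists_completedRiemannZeta₀_eq_mellin
  have h2 : conj s / 2 = conj (s / 2) := by rw [map_div₀, map_ofNat]
  rw [riemannXi, riemannXi, hf, hf, h2, mellin_ofReal_conj]
  simp only [map_add, map_mul, map_sub, map_one, map_div₀,
    map_ofNat]

lemma exists_norm_completedRiemannZeta₀_le (a b : ℝ) :
    ∃ C, ∀ s : ℂ, a ≤ s.re → s.re ≤ b → ‖completedRiemannZeta₀ s‖ ≤ C := by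
  obtain ⟨f, hc, hf⟩ := exists_completedRiemannZeta₀_eq_mellin
  have hint : ∀ σ : ℝ, MeasureTheory.IntegrableOn (fun x : ℝ ↦ x ^ (σ / 2 - 1) * |f x|)
      (Set.Ioi 0) := by
    intro σ
    refine MeasureTheory.IntegrableOn.congr_fun (hc (σ / 2 : ℝ)).norm
      (fun x (hx : 0 < x) ↦ ?_) measurableSet_Ioi
    rw [norm_smul, Complex.norm_cpow_eq_rpow_re_of_pos hx]
    simp
  -- For `x > 0` a power with exponent between two others is at most the sum of those two powers.
  refine ⟨(∫ x in Set.Ioi (0 : ℝ), (x ^ (a / 2 - 1) * |f x| + x ^ (b / 2 - 1) * |f x|)) / 2,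
    fun s ha hb ↦ ?_⟩
  rw [hf, norm_div, mellin, Complex.norm_ofNat]
  gcongr
  refine MeasureTheory.norm_integral_le_of_norm_le ((hint a).add (hint b)) ?_
  filter_upwards [MeasureTheory.ae_restrict_mem measurableSet_Ioi] with x hx
  have hx : 0 < x := hx
  rw [norm_smul, Complex.norm_cpow_eq_rpow_re_of_pos hx, Complex.norm_real, Real.norm_eq_abs,
    ← add_mul]
  gcongr
  have hre : (s / 2 - 1).re = s.re / 2 - 1 := by simp
  rw [hre]
  rcases le_total 1 x with h | h
  · have := Real.rpow_le_rpow_of_exponent_le h (show s.re / 2 - 1 ≤ b / 2 - 1 by linarith)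
    have := Real.rpow_nonneg hx.le (a / 2 - 1)
    linarith
  · have := Real.rpow_le_rpow_of_exponent_ge hx h (show a / 2 - 1 ≤ s.re / 2 - 1 by linarith)
    have := Real.rpow_nonneg hx.le (b / 2 - 1)
    linarith

lemma exists_norm_riemannXi_le (a b : ℝ) :
    ∃ B > 0, ∀ s : ℂ, a ≤ s.re → s.re ≤ b → ‖riemannXi s‖ ≤ Real.exp (B * (1 + |s.im|)) := by
  obtain ⟨C, hC⟩ := exists_norm_completedRiemannZeta₀_le a b
  set K := (1 + |a| + |b|) * (2 + |a| + |b|) * |C| + 1 with hK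
  have hK0 : 0 < K := by positivity
  refine ⟨K + 2, by positivity, fun s ha hb ↦ ?_⟩
  have h1 : ‖s‖ ≤ (1 + |a| + |b|) * (1 + |s.im|) := by
    have h2 := Complex.norm_le_abs_re_add_abs_im s
    have h3 : |s.re| ≤ |a| + |b| := by
      rw [abs_le]
      constructor <;> linarith [neg_abs_le a, le_abs_self b, abs_nonneg a, abs_nonneg b]
    nlinarith [abs_nonneg a, abs_nonneg b, abs_nonneg s.im]
  have h2 : ‖s - 1‖ ≤ (2 + |a| + |b|) * (1 + |s.im|) := by
    have := norm_sub_le s 1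
    rw [norm_one] at this
    linarith [abs_nonneg s.im]
  calc ‖riemannXi s‖ ≤ ‖s‖ * ‖s - 1‖ * ‖completedRiemannZeta₀ s‖ + 1 := by
        rw [riemannXi, ← norm_mul, ← norm_mul]
        exact (norm_add_le _ _).trans (by simp)
    _ ≤ ((1 + |a| + |b|) * (1 + |s.im|)) * ((2 + |a| + |b|) * (1 + |s.im|)) * |C|
        + 1 * (1 + |s.im|) ^ 2 := by
        gcongr
        · exact (hC s ha hb).trans (le_abs_self C)
        · nlinarith [abs_nonneg s.im]
    _ = K * (1 + |s.im|) ^ 2 := by ring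
    _ ≤ Real.exp (K * (1 + |s.im|)) * Real.exp (1 + |s.im|) ^ 2 := by
        gcongr
        · have := Real.add_one_le_exp (K * (1 + |s.im|))
          nlinarith [abs_nonneg s.im]
        · have := Real.add_one_le_exp (1 + |s.im|)
          linarith
    _ = Real.exp ((K + 2) * (1 + |s.im|)) := by
        rw [← Real.exp_nat_mul, ← Real.exp_add]
        congr 1
        push_cast
        ring

/-! ### Logarithmic derivatives of the Gamma factor, `ζ` and `ξ` -/

open Complex in
lemma differentiableAt_Gammaℝ {s : ℂ} (hs : 0 < s.re) : DifferentiableAt ℂ Gammaℝ s := by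
  have h := (differentiable_Gammaℝ_inv s).inv (inv_ne_zero (Gammaℝ_ne_zero_of_re_pos hs))
  have h2 : (fun s : ℂ ↦ (Gammaℝ s)⁻¹)⁻¹ = Gammaℝ := by ext z; simp
  rwa [h2] at h

open Complex in
lemma logDeriv_Gammaℝ {s : ℂ} (hs : 0 < s.re) :
    logDeriv Gammaℝ s = -Real.log Real.pi / 2 + digamma (s / 2) / 2 := by
  have hpi : (Real.pi : ℂ) ≠ 0 := ofReal_ne_zero.2 Real.pi_ne_zero
  have hs2 : 0 < (s / 2).re := by simpa using hs
  have hG : DifferentiableAt ℂ Gamma (s / 2) := differentiableAt_Gamma _ fun m hm ↦ by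
    rw [hm] at hs2
    simp at hs2
    have : (0 : ℝ) ≤ m := m.cast_nonneg
    linarith
  have h1 : HasDerivAt (fun z : ℂ ↦ (Real.pi : ℂ) ^ (-z / 2))
      ((Real.pi : ℂ) ^ (-s / 2) * Complex.log Real.pi * (-1 / 2)) s :=
    HasDerivAt.const_cpow (((hasDerivAt_id s).neg).div_const 2) (Or.inl hpi)
  have h2 : HasDerivAt (fun z : ℂ ↦ Gamma (z / 2)) (deriv Gamma (s / 2) * (1 / 2)) s :=
    HasDerivAt.comp s hG.hasDerivAt ((hasDerivAt_id s).div_const 2)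
  have h3 : HasDerivAt Gammaℝ _ s := h1.mul h2
  have h4 : (Real.pi : ℂ) ^ (-s / 2) ≠ 0 := by simp [cpow_eq_zero_iff, hpi]
  have h5 := Gamma_ne_zero_of_re_pos hs2
  rw [logDeriv_apply, h3.deriv, Gammaℝ_def, digamma_def, logDeriv_apply, ofReal_log
    Real.pi_pos.le]
  field_simp

open Complex in
lemma logDeriv_mul_sub_one_mul_Gammaℝ {s : ℂ} (hs : 0 < s.re) (h1 : s ≠ 1) :
    logDeriv (fun z ↦ z * (z - 1) * Gammaℝ z) s
      = s⁻¹ + (s - 1)⁻¹ + (-Real.log Real.pi / 2 + digamma (s / 2) / 2) := by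
  have h0 : s ≠ 0 := by rintro rfl; simp at hs
  have h1' : s - 1 ≠ 0 := sub_ne_zero.2 h1
  rw [logDeriv_mul (f := fun z ↦ z * (z - 1)) s (mul_ne_zero h0 h1')
    (Gammaℝ_ne_zero_of_re_pos hs) (by fun_prop) (differentiableAt_Gammaℝ hs), logDeriv_Gammaℝ hs,
    logDeriv_mul (f := fun z ↦ z) (g := fun z ↦ z - 1) s h0 h1' (by fun_prop) (by fun_prop)]
  simp [logDeriv_apply]

open Complex in
lemma exists_forall_le_re_logDeriv_mul_Gammaℝ (K : ℝ) : ∃ T : ℝ, ∀ s : ℂ, 0 < s.re → T ≤ s.im →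
    K ≤ (logDeriv (fun z ↦ z * (z - 1) * Gammaℝ z) s).re := by
  -- The 1 absorbs `Re (s - 1)⁻¹ ≥ -1`, and `3/4` is half the digamma error `3/2`.
  obtain ⟨T, hT⟩ := (Real.tendsto_log_atTop.eventually_ge_atTop
    (2 * (K + 1 + Real.log Real.pi / 2 + 3 / 4))).exists_forall_of_atTop
  refine ⟨max 2 (2 * T), fun s hs ht ↦ ?_⟩
  have ht1 : 2 ≤ s.im := (le_max_left _ _).trans ht
  have ht2 : 2 * T ≤ s.im := (le_max_right _ _).trans ht
  have h1 : s ≠ 1 := by rintro rfl; norm_num at ht1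
  rw [logDeriv_mul_sub_one_mul_Gammaℝ hs h1]
  have him : (s / 2).im = s.im / 2 := by simp
  have hd := log_im_sub_le_re_digamma (u := s / 2) (by simpa using hs) (by rw [him]; linarith)
  have hl := hT (s.im / 2) (by linarith)
  rw [him] at hd
  have ha : 0 ≤ (s⁻¹).re := by
    rw [inv_re]
    exact div_nonneg hs.le (normSq_nonneg _)
  have hb : -1 ≤ ((s - 1)⁻¹).re := by
    have h3 : 1 ≤ ‖s - 1‖ := by
      have := abs_im_le_norm (s - 1)
      simp only [sub_im, one_im, sub_zero] at this
      rw [abs_of_nonneg (by linarith)] at this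
      linarith
    have h4 : ‖(s - 1)⁻¹‖ ≤ 1 := by
      rw [norm_inv]
      exact inv_le_one_of_one_le₀ h3
    linarith [(abs_le.1 (abs_re_le_norm ((s - 1)⁻¹))).1]
  have hc : ((-Real.log Real.pi / 2 + digamma (s / 2) / 2 : ℂ)).re
      = -Real.log Real.pi / 2 + (digamma (s / 2)).re / 2 := by
    simp [div_ofNat_re]
  rw [add_re, add_re, hc]
  linarith

lemma norm_LSeries_le_of_re_le_re {f : ℕ → ℂ} {s₀ s : ℂ} (hf : LSeriesSummable f s₀)
    (h : s₀.re ≤ s.re) : ‖LSeries f s‖ ≤ ∑' n, ‖LSeries.term f s₀ n‖ :=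
  tsum_of_norm_bounded hf.norm.hasSum fun n ↦ LSeries.norm_term_le_of_re_le_re f h n

open ArithmeticFunction in
lemma exists_norm_logDeriv_riemannZeta_le :
    ∃ K, ∀ s : ℂ, 2 ≤ s.re → ‖logDeriv riemannZeta s‖ ≤ K := by
  refine ⟨∑' n, ‖LSeries.term (fun n ↦ ((vonMangoldt n : ℝ) : ℂ)) 2 n‖, fun s hs ↦ ?_⟩
  have h1 := norm_LSeries_le_of_re_le_re (s := s)
    (LSeriesSummable_vonMangoldt (s := 2) (by norm_num)) (by simpa using hs)
  rw [LSeries_vonMangoldt_eq_deriv_riemannZeta_div (by linarith), neg_div, norm_neg] at h1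
  exact h1

open ArithmeticFunction in
-- The Möbius series bounds `1/ζ` uniformly.
lemma exists_le_norm_riemannZeta : ∃ c > 0, ∀ s : ℂ, 2 ≤ s.re → c ≤ ‖riemannZeta s‖ := by
  have hsum : LSeriesSummable (fun n ↦ ((moebius n : ℤ) : ℂ)) 2 :=
    LSeriesSummable_moebius_iff.2 (by norm_num)
  set K := ∑' n, ‖LSeries.term (fun n ↦ ((moebius n : ℤ) : ℂ)) 2 n‖
  have hK : 0 ≤ K := tsum_nonneg fun _ ↦ norm_nonneg _
  refine ⟨(K + 1)⁻¹, by positivity, fun s hs ↦ ?_⟩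
  have h1 := norm_LSeries_le_of_re_le_re (s := s) hsum (by simpa using hs)
  have h2 := LSeries_zeta_mul_Lseries_moebius (s := s) (by linarith)
  rw [LSeries_zeta_eq_riemannZeta (by linarith)] at h2
  have h3 := congrArg norm h2
  rw [norm_mul, norm_one] at h3
  rw [inv_le_iff_one_le_mul₀ (by positivity), ← h3]
  gcongr
  linarith

lemma logDeriv_riemannXi {s : ℂ} (h0 : 0 < s.re) (h1 : s ≠ 1) (hz : riemannZeta s ≠ 0) :
    logDeriv riemannXi s
      = logDeriv (fun z ↦ z * (z - 1) * Complex.Gammaℝ z) s + logDeriv riemannZeta s := by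
  have he : riemannXi =ᶠ[nhds s] fun z ↦ z * (z - 1) * Complex.Gammaℝ z * riemannZeta z := by
    filter_upwards [(isOpen_lt continuous_const Complex.continuous_re).mem_nhds h0,
      isOpen_ne.mem_nhds h1] with z hz0 hz1
    exact riemannXi_eq_Gammaℝ_mul hz0 hz1
  have hs : s ≠ 0 := by rintro rfl; simp at h0
  have hg := differentiableAt_Gammaℝ h0
  rw [logDeriv_apply, he.deriv_eq, he.eq_of_nhds, ← logDeriv_apply,
    logDeriv_mul (f := fun z ↦ z * (z - 1) * Complex.Gammaℝ z) s
      (mul_ne_zero (mul_ne_zero hs (sub_ne_zero.2 h1)) (Complex.Gammaℝ_ne_zero_of_re_pos h0)) hz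
      (by fun_prop) (differentiableAt_riemannZeta h1)]

/-- Far to the right the digamma term grows like `log (Re s)` and beats the bounded `ζ'/ζ`. -/
lemma exists_forall_re_logDeriv_riemannXi_nonneg :
    ∃ σ₀ : ℝ, 2 ≤ σ₀ ∧ ∀ s : ℂ, σ₀ ≤ s.re → 0 ≤ (logDeriv riemannXi s).re := by
  obtain ⟨K, hK⟩ := exists_norm_logDeriv_riemannZeta_le
  obtain ⟨T, hT⟩ := (Real.tendsto_log_atTop.eventually_ge_atTop
    (2 * (K + Real.log Real.pi / 2))).exists_forall_of_atTop
  refine ⟨max 4 (2 * (T + 1)), by simp; norm_num, fun s hs ↦ ?_⟩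
  have hs1 : 4 ≤ s.re := (le_max_left _ _).trans hs
  have hs2 : 2 * (T + 1) ≤ s.re := (le_max_right _ _).trans hs
  have h1 : s ≠ 1 := by rintro rfl; norm_num at hs1
  rw [logDeriv_riemannXi (by linarith) h1 (riemannZeta_ne_zero_of_one_le_re (by linarith)),
    logDeriv_mul_sub_one_mul_Gammaℝ (by linarith) h1]
  have hre : (s / 2).re = s.re / 2 := by simp
  have hinv : ∀ z : ℂ, 0 ≤ z.re → 0 ≤ (z⁻¹).re := fun z hz ↦ by
    rw [Complex.inv_re]
    exact div_nonneg hz (Complex.normSq_nonneg _)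
  have ha := hinv s (by linarith)
  have hb := hinv (s - 1) (by simp; linarith)
  have hl := hT (s.re / 2 - 1) (by linarith)
  have hd := log_le_re_digamma (u := s / 2) (by linarith)
  rw [hre] at hd
  have hz := (abs_le.1 ((Complex.abs_re_le_norm _).trans (hK s (by linarith)))).1
  have hc : ((-Real.log Real.pi / 2 + Complex.digamma (s / 2) / 2 : ℂ)).re
      = -Real.log Real.pi / 2 + (Complex.digamma (s / 2)).re / 2 := by
    simp [Complex.div_ofNat_re]
  rw [Complex.add_re, Complex.add_re, Complex.add_re, hc]
  linarith

/-! ### Size of `|ξ|` along horizontal and vertical lines -/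

open Complex ComplexConjugate in
lemma re_conj_mul_deriv_eq (f : ℂ → ℂ) (s : ℂ) :
    (conj (f s) * deriv f s).re = ‖f s‖ ^ 2 * (logDeriv f s).re := by
  rcases eq_or_ne (f s) 0 with h | h
  · simp [h]
  · rw [← re_ofReal_mul, ofReal_pow, ← conj_mul', logDeriv_apply]
    congr 1
    field_simp

/-- If the logarithmic derivative of `f` has nonnegative real part on a right half plane,
then `|f|` increases to the right there. -/
lemma norm_le_norm_add_of_re_logDeriv_nonneg {f : ℂ → ℂ} {σ : ℝ} (hf : Differentiable ℂ f)
    (h : ∀ s : ℂ, σ ≤ s.re → 0 ≤ (logDeriv f s).re) {s : ℂ} (hs : σ ≤ s.re) {x : ℝ} (hx : 0 ≤ x) :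
    ‖f s‖ ≤ ‖f (s + x)‖ := by
  have hd : ∀ y : ℝ, HasDerivAt (fun y : ℝ ↦ ‖f (s + y)‖ ^ 2) _ y :=
    fun y ↦ (hf (s + y)).hasDerivAt.normSq_comp_add_ofReal
  have hm : MonotoneOn (fun y : ℝ ↦ ‖f (s + y)‖ ^ 2) (Set.Ici 0) := by
    refine monotoneOn_of_deriv_nonneg (convex_Ici 0)
      (fun y _ ↦ (hd y).continuousAt.continuousWithinAt)
      (fun y _ ↦ (hd y).differentiableAt.differentiableWithinAt) fun y hy ↦ ?_
    rw [interior_Ici] at hy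
    have hy : 0 < y := hy
    rw [(hd y).deriv, re_conj_mul_deriv_eq]
    have := h (s + y) (by simp; linarith)
    positivity
  have h1 := hm (Set.mem_Ici.2 le_rfl) (Set.mem_Ici.2 hx) hx
  simp only [Complex.ofReal_zero, add_zero] at h1
  exact (sq_le_sq₀ (norm_nonneg _) (norm_nonneg _)).1 h1

lemma norm_riemannXi_sub_eq {s : ℂ} (hs : s.re = 1 / 2) (h : ℝ) :
    ‖riemannXi (s - h)‖ = ‖riemannXi (s + h)‖ := by
  have h1 : 1 - (s - h) = (starRingEnd ℂ) (s + h) := by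
    apply Complex.ext
    · simp [hs]; ring
    · simp
  rw [← riemannXi_one_sub, h1, riemannXi_conj, Complex.norm_conj]

open Complex in
/-- A lower bound for `ξ` on a vertical line far to the right. -/
lemma exists_exp_neg_le_norm_riemannXi {m : ℕ} (hm : 1 ≤ m) : ∃ B > 0, ∀ t : ℝ,
    Real.exp (-(B * (1 + |t|))) ≤ ‖riemannXi (2 * m + 1 + t * I)‖ := by
  obtain ⟨c, hc, hcG⟩ := exists_exp_neg_le_norm_Gamma m
  obtain ⟨d, hd, hdζ⟩ := exists_le_norm_riemannZeta
  have hm' : (1 : ℝ) ≤ m := by exact_mod_cast hm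
  set q := (Real.pi ^ (-(m + 1 / 2) : ℝ) * d) ^ 2 * c with hq
  have hq0 : 0 < q := by have := Real.pi_pos; positivity
  refine ⟨q⁻¹ + Real.pi, by have := Real.pi_pos; positivity, fun t ↦ ?_⟩
  set w : ℂ := 2 * m + 1 + t * I with hw
  have hre : w.re = 2 * m + 1 := by simp [hw]
  have h1 : w ≠ 1 := fun h ↦ by
    have := congrArg re h
    rw [hre, one_re] at this
    linarith
  have hw1 : 1 ≤ ‖w‖ := by
    have := abs_re_le_norm w
    rw [hre, abs_of_nonneg (by linarith)] at this
    linarith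
  have hw2 : 1 ≤ ‖w - 1‖ := by
    have := abs_re_le_norm (w - 1)
    rw [sub_re, hre, one_re, abs_of_nonneg (by linarith)] at this
    linarith
  have hw3 : w / 2 = m + 1 / 2 + (t / 2 : ℝ) * I := by
    rw [hw]; push_cast; ring
  have hG := hcG (t / 2)
  have hζ := hdζ w (by linarith)
  have hpi : ‖(Real.pi : ℂ) ^ (-w / 2)‖ = Real.pi ^ (-(m + 1 / 2) : ℝ) := by
    rw [norm_cpow_eq_rpow_re_of_pos Real.pi_pos]
    congr 1
    rw [div_ofNat_re, neg_re, hre]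
    ring
  rw [riemannXi_eq_Gammaℝ_mul (by linarith) h1, Gammaℝ_def]
  have hsq : q * Real.exp (-(Real.pi * |t / 2|))
      ≤ ‖w * (w - 1) * (↑Real.pi ^ (-w / 2) * Gamma (w / 2)) * riemannZeta w‖ ^ 2 := by
    simp only [norm_mul, hpi, hw3]
    have h2 : 1 ≤ ‖w‖ * ‖w - 1‖ := one_le_mul_of_one_le_of_one_le hw1 hw2
    calc q * Real.exp (-(Real.pi * |t / 2|))
        = 1 ^ 2 * (Real.pi ^ (-(m + 1 / 2) : ℝ)) ^ 2 * (c * Real.exp (-(Real.pi * |t / 2|)))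
            * d ^ 2 := by rw [hq]; ring
      _ ≤ (‖w‖ * ‖w - 1‖) ^ 2 * (Real.pi ^ (-(m + 1 / 2) : ℝ)) ^ 2 *
            ‖Gamma (m + 1 / 2 + (t / 2 : ℝ) * I)‖ ^ 2 * ‖riemannZeta w‖ ^ 2 := by gcongr
      _ = _ := by ring
  refine (sq_le_sq₀ (Real.exp_pos _).le (norm_nonneg _)).1 (le_trans ?_ hsq)
  have hq1 : Real.exp (-q⁻¹) ≤ q := by
    rw [Real.exp_neg]
    refine inv_le_of_inv_le₀ hq0 ?_
    linarith [Real.add_one_le_exp q⁻¹]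
  calc Real.exp (-((q⁻¹ + Real.pi) * (1 + |t|))) ^ 2
      ≤ Real.exp (-q⁻¹) * Real.exp (-(Real.pi * |t / 2|)) := by
        rw [← Real.exp_nat_mul, ← Real.exp_add, Real.exp_le_exp, abs_div, abs_two]
        push_cast
        have : 0 ≤ q⁻¹ * |t| := by positivity
        have : 0 ≤ Real.pi * |t| := by have := Real.pi_pos; positivity
        have : 0 < q⁻¹ := by positivity
        nlinarith [Real.pi_pos]
    _ ≤ _ := by gcongr

open Complex Metric in
/-- Under the Riemann hypothesis, `ξ` is not too small to the right of the critical line. -/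
lemma RiemannHypothesis.exists_exp_neg_le_norm_riemannXi (hRH : RiemannHypothesis) {h b : ℝ}
    (hh : 0 < h) : ∃ B > 0, ∀ s : ℂ, 1 / 2 + h ≤ s.re → s.re ≤ b →
      Real.exp (-(B * (1 + |s.im|))) ≤ ‖riemannXi s‖ := by
  obtain ⟨m, hm⟩ := exists_nat_ge (max 1 (b + h))
  have hm1 : (1 : ℝ) ≤ m := (le_max_left _ _).trans hm
  have hbm : b + h ≤ 2 * (m : ℝ) := by linarith [(le_max_right _ _).trans hm]
  obtain ⟨B₁, hB₁, hlow⟩ := _root_.exists_exp_neg_le_norm_riemannXi (m := m) (by exact_mod_cast hm1)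
  -- The disc about `2m + 1 + i Im s` of this radius touches the critical line, so RH makes `ξ`
  -- zero-free in it, while `s` stays at distance at least `h` from its boundary.
  set R : ℝ := 2 * m + 1 / 2 with hR
  have hR0 : 0 < R := by positivity
  obtain ⟨B₂, hB₂, hup⟩ := exists_norm_riemannXi_le (1 / 2) (2 * R + 1 / 2)
  refine ⟨B₁ + 2 * (B₁ + B₂ * (1 + R)) * (|R - h| / h), by positivity, fun s hs1 hs2 ↦ ?_⟩
  set w : ℂ := 2 * m + 1 + s.im * I with hw
  have hwre : w.re = 2 * m + 1 := by simp [hw]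
  have hwim : w.im = s.im := by simp [hw]
  have hball : ∀ z ∈ ball w R, 1 / 2 < z.re ∧ z.re ≤ 2 * R + 1 / 2 ∧ |z.im| ≤ |s.im| + R := by
    intro z hz
    rw [mem_ball, dist_eq_norm] at hz
    have h1 := abs_lt.1 ((abs_re_le_norm (z - w)).trans_lt hz)
    have h2 := (abs_im_le_norm (z - w)).trans_lt hz
    rw [sub_re, hwre] at h1
    rw [sub_im, hwim] at h2
    have h3 := abs_sub_abs_le_abs_sub z.im s.im
    refine ⟨?_, ?_, ?_⟩ <;> linarith [h1.1, h1.2]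
  have hsw : ‖s - w‖ = 2 * m + 1 - s.re := by
    have : s - w = ((s.re - (2 * m + 1) : ℝ) : ℂ) := by
      apply Complex.ext
      · rw [sub_re, hwre, ofReal_re]
      · rw [sub_im, hwim, ofReal_im, sub_self]
    rw [this, norm_real, Real.norm_eq_abs, abs_sub_comm, abs_of_nonneg (by linarith)]
  have key := norm_center_mul_exp_neg_le (f := riemannXi) (c := w) (z := s) (R := R) (r := R - h)
    (M := (B₁ + B₂ * (1 + R)) * (1 + |s.im|)) differentiable_riemannXi.differentiableOn
    (fun z hz ↦ hRH.riemannXi_ne_zero (hball z hz).1) (by positivity) (fun z hz ↦ by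
      obtain ⟨h1, h2, h3⟩ := hball z hz
      have h4 := hlow s.im
      calc ‖riemannXi z‖ ≤ Real.exp (B₂ * (1 + |z.im|)) := hup z h1.le h2
        _ ≤ Real.exp (-(B₁ * (1 + |s.im|))) *
              Real.exp ((B₁ + B₂ * (1 + R)) * (1 + |s.im|)) := by
            rw [← Real.exp_add, Real.exp_le_exp]
            have : B₂ * |z.im| ≤ B₂ * (|s.im| + R) := by gcongr
            have : 0 ≤ B₂ * (R * |s.im|) := by positivity
            nlinarith
        _ ≤ _ := by gcongr) (by linarith) (by linarith)
  refine le_trans ?_ key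
  calc Real.exp (-((B₁ + 2 * (B₁ + B₂ * (1 + R)) * (|R - h| / h)) * (1 + |s.im|)))
      = Real.exp (-(B₁ * (1 + |s.im|))) *
        Real.exp (-(2 * ((B₁ + B₂ * (1 + R)) * (1 + |s.im|)) * |R - h| / h)) := by
        rw [← Real.exp_add]
        congr 1
        field_simp
        ring
    _ ≤ Real.exp (-(B₁ * (1 + |s.im|))) *
        Real.exp (-(2 * ((B₁ + B₂ * (1 + R)) * (1 + |s.im|)) * (R - h) / h)) := by
        gcongr
        exact le_abs_self _
    _ ≤ _ := by
        rw [sub_sub_cancel]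
        gcongr
        exact hlow s.im

/-! ### Phragmén–Lindelöf comparison of `ξ(s - h)` and `ξ(s + h)` -/

open Complex Filter in
lemma isBigO_exp_comap_abs_im {f : ℂ → ℂ} {a b B : ℝ} (hB : 0 ≤ B)
    (h : ∀ s : ℂ, a < s.re → s.re < b → ‖f s‖ ≤ Real.exp (B * (1 + |s.im|))) {c : ℝ} (hc : 0 < c) :
    f =O[comap (abs ∘ im) atTop ⊓ 𝓟 (re ⁻¹' Set.Ioo a b)]
      fun z ↦ Real.exp ((B * (1 + c⁻¹)) * Real.exp (c * |z.im|)) := by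
  refine Asymptotics.IsBigO.of_bound 1 (Eventually.filter_mono inf_le_right ?_)
  rw [eventually_principal]
  intro s hs
  rw [one_mul, Real.norm_of_nonneg (Real.exp_pos _).le]
  refine (h s hs.1 hs.2).trans (Real.exp_le_exp.2 ?_)
  rw [mul_assoc]
  gcongr
  have h1 := Real.add_one_le_exp (c * |s.im|)
  have h2 : |s.im| ≤ c⁻¹ * Real.exp (c * |s.im|) := by
    rw [← div_eq_inv_mul, le_div_iff₀ hc]
    linarith
  have h3 : 0 ≤ c * |s.im| := by positivity
  linarith

open Complex in
/-- Under the Riemann hypothesis, `|ξ|` takes larger values farther from the critical line. -/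
lemma RiemannHypothesis.norm_riemannXi_sub_le (hRH : RiemannHypothesis) {h : ℝ} (hh : 0 < h)
    {s : ℂ} (hs : 1 / 2 ≤ s.re) : ‖riemannXi (s - h)‖ ≤ ‖riemannXi (s + h)‖ := by
  obtain ⟨σ₀, hσ₀, hpos⟩ := exists_forall_re_logDeriv_riemannXi_nonneg
  set b := σ₀ + h
  have hright : ∀ z : ℂ, b ≤ z.re → ‖riemannXi (z - h)‖ ≤ ‖riemannXi (z + h)‖ := by
    intro z hz
    have := norm_le_norm_add_of_re_logDeriv_nonneg differentiable_riemannXi hpos (s := z - h)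
      (by simp; linarith) (x := 2 * h) (by linarith)
    convert this using 3
    push_cast; ring
  rcases le_total b s.re with hb | hb
  · exact hright s hb
  have hne : ∀ z : ℂ, 1 / 2 ≤ z.re → riemannXi (z + h) ≠ 0 := fun z hz ↦
    hRH.riemannXi_ne_zero (by simp at hz ⊢; linarith)
  obtain ⟨B₁, hB₁, h1⟩ := hRH.exists_exp_neg_le_norm_riemannXi hh (b := b + h)
  obtain ⟨B₂, hB₂, h2⟩ := exists_norm_riemannXi_le (1 / 2 - h) b
  have hdiff : ∀ z : ℂ, 1 / 2 ≤ z.re →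
      DifferentiableAt ℂ (fun z : ℂ ↦ riemannXi (z - h) / riemannXi (z + h)) z := fun z hz ↦ by
    have := differentiable_riemannXi
    exact DifferentiableAt.div (by fun_prop) (by fun_prop) (hne z hz)
  have hc : 0 < Real.pi / (b - 1 / 2) / 2 := by
    have : 0 < b - 1 / 2 := by linarith
    have := Real.pi_pos
    positivity
  -- On the left edge the quotient has modulus 1 by symmetry; on the right edge `hright` applies.
  -- Half of `π / (b - 1/2)` serves as an exponent strictly below the critical one.
  have key := PhragmenLindelof.vertical_strip
    (f := fun z : ℂ ↦ riemannXi (z - h) / riemannXi (z + h)) (a := 1 / 2) (b := b) (C := 1) (z := s)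
    (DifferentiableOn.diffContOnCl fun z hz ↦ by
      have hz' : z ∈ re ⁻¹' Set.Ici (1 / 2) :=
        closure_minimal (Set.preimage_mono fun x (hx : x ∈ Set.Ioo _ _) ↦ hx.1.le)
          (isClosed_Ici.preimage continuous_re) hz
      exact (hdiff z hz').differentiableWithinAt)
    ⟨Real.pi / (b - 1 / 2) / 2, by linarith, (B₁ + B₂) * (1 + (Real.pi / (b - 1 / 2) / 2)⁻¹),
      isBigO_exp_comap_abs_im (by positivity) (fun z hz1 hz2 ↦ by
        have h3 := h1 (z + h) (by simp at hz1 ⊢; linarith) (by simp; linarith)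
        have h4 := h2 (z - h) (by simp at hz1 ⊢; linarith) (by simp; linarith)
        rw [add_im, ofReal_im, add_zero] at h3
        rw [sub_im, ofReal_im, sub_zero] at h4
        rw [norm_div, div_le_iff₀ ((Real.exp_pos _).trans_le h3)]
        calc _ ≤ Real.exp (B₂ * (1 + |z.im|)) := h4
          _ = Real.exp ((B₁ + B₂) * (1 + |z.im|)) * Real.exp (-(B₁ * (1 + |z.im|))) := by
            rw [← Real.exp_add]; ring_nf
          _ ≤ _ := by gcongr) hc⟩
    (fun z hz ↦ by
      rw [norm_div, norm_riemannXi_sub_eq hz]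
      exact div_self_le_one _)
    (fun z hz ↦ by
      rw [norm_div]
      exact div_le_one_of_le₀ (hright z hz.ge) (norm_nonneg _)) hs hb
  rwa [norm_div, div_le_one (norm_pos_iff.2 (hne s hs))] at key

/-! ### `ξ'/ξ` right of and on the critical line -/

open Complex in
lemma hasDerivAt_normSq_riemannXi_add_sub (s : ℂ) :
    HasDerivAt (fun y : ℝ ↦ ‖riemannXi (s + y)‖ ^ 2 - ‖riemannXi (s - y)‖ ^ 2)
      (‖riemannXi s‖ ^ 2 * (4 * (logDeriv riemannXi s).re)) 0 := by
  have hd : HasDerivAt riemannXi (deriv riemannXi s) (s + (0 : ℝ)) := by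
    simpa using (differentiable_riemannXi s).hasDerivAt
  -- Reflecting in `s` turns `ξ(s - y)` into a function evaluated at `s + y`, as
  -- `HasDerivAt.normSq_comp_add_ofReal` requires.
  have hd' : HasDerivAt (fun z ↦ riemannXi (s - (z - s))) (-deriv riemannXi s) (s + (0 : ℝ)) := by
    have h1 : HasDerivAt riemannXi (deriv riemannXi s) (s - (s + (0 : ℝ) - s)) := by
      simpa using (differentiable_riemannXi s).hasDerivAt
    have h2 : HasDerivAt (fun z ↦ s - (z - s)) (-1) (s + (0 : ℝ)) := by
      simpa using! ((hasDerivAt_id (s + (0 : ℝ))).sub_const s).const_sub s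
    simpa using! HasDerivAt.comp (h := fun z ↦ s - (z - s)) (s + (0 : ℝ)) h1 h2
  have h2 := hd.normSq_comp_add_ofReal.sub hd'.normSq_comp_add_ofReal
  simp only [ofReal_zero, add_zero, sub_self, sub_zero, mul_neg, neg_re, re_conj_mul_deriv_eq,
    add_sub_cancel_left] at h2
  convert! h2 using 1
  ring

lemma RiemannHypothesis.re_logDeriv_riemannXi_nonneg (hRH : RiemannHypothesis) {s : ℂ}
    (hs : 1 / 2 ≤ s.re) : 0 ≤ (logDeriv riemannXi s).re := by
  rcases eq_or_ne (riemannXi s) 0 with h0 | h0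
  · simp [logDeriv_apply, h0]
  have h2 := (hasDerivAt_normSq_riemannXi_add_sub s).nonneg_of_forall_le (by
    intro y hy
    have := hRH.norm_riemannXi_sub_le hy hs
    simp only [Complex.ofReal_zero, add_zero, sub_zero, sub_self, sub_nonneg]
    gcongr)
  have h3 : 0 < ‖riemannXi s‖ ^ 2 := by positivity
  linarith [nonneg_of_mul_nonneg_right h2 h3]

lemma re_logDeriv_riemannXi_eq_zero {s : ℂ} (hs : s.re = 1 / 2) :
    (logDeriv riemannXi s).re = 0 := by
  rcases eq_or_ne (riemannXi s) 0 with h0 | h0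
  · simp [logDeriv_apply, h0]
  have h1 := hasDerivAt_normSq_riemannXi_add_sub s
  simp only [norm_riemannXi_sub_eq hs, sub_self] at h1
  have h2 := h1.unique (hasDerivAt_const _ _)
  simpa [h0] using h2

lemma differentiableAt_logDeriv_riemannXi {s : ℂ} (h0 : riemannXi s ≠ 0) :
    DifferentiableAt ℂ (logDeriv riemannXi) s :=
  (differentiable_riemannXi.deriv s).div (differentiable_riemannXi s) h0

open Complex in
-- `Re ξ'/ξ` vanishes along the line, and its vertical derivative is `Re (i (ξ'/ξ)') = -Im (ξ'/ξ)'`.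
lemma im_deriv_logDeriv_riemannXi_eq_zero {s : ℂ} (hs : s.re = 1 / 2) (h0 : riemannXi s ≠ 0) :
    (deriv (logDeriv riemannXi) s).im = 0 := by
  have h1 : HasDerivAt (logDeriv riemannXi) (deriv (logDeriv riemannXi) s) (s + I * (0 : ℝ)) := by
    simpa using (differentiableAt_logDeriv_riemannXi h0).hasDerivAt
  have h2 : HasDerivAt (fun y : ℂ ↦ s + I * y) I ((0 : ℝ) : ℂ) := by
    simpa using! ((hasDerivAt_id (((0 : ℝ) : ℂ))).const_mul I).const_add s
  have h3 := (HasDerivAt.comp (h := fun y ↦ s + I * y) ((0 : ℝ) : ℂ) h1 h2).real_of_complex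
  have h4 : (fun y : ℝ ↦ (logDeriv riemannXi (s + I * y)).re) = fun _ ↦ 0 := by
    ext y
    exact re_logDeriv_riemannXi_eq_zero (by simp [hs])
  simp only [Function.comp_apply, h4] at h3
  simpa using h3.unique (hasDerivAt_const _ _)

open Complex in
/-- Under the Riemann hypothesis, `ξ` satisfies the Laguerre inequality on the critical line. -/
lemma RiemannHypothesis.re_deriv_logDeriv_riemannXi_nonneg (hRH : RiemannHypothesis) {s : ℂ}
    (hs : s.re = 1 / 2) (h0 : riemannXi s ≠ 0) : 0 ≤ (deriv (logDeriv riemannXi) s).re := by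
  have h1 : HasDerivAt (logDeriv riemannXi) (deriv (logDeriv riemannXi) s) (s + (0 : ℝ)) := by
    simpa using (differentiableAt_logDeriv_riemannXi h0).hasDerivAt
  have h2 : HasDerivAt (fun y : ℂ ↦ s + y) 1 ((0 : ℝ) : ℂ) := by
    simpa using! (hasDerivAt_id (((0 : ℝ) : ℂ))).const_add s
  have h3 := (HasDerivAt.comp (h := fun y ↦ s + y) ((0 : ℝ) : ℂ) h1 h2).real_of_complex
  rw [mul_one] at h3
  refine h3.nonneg_of_forall_le fun y hy ↦ ?_
  simp only [Function.comp_apply, ofReal_zero, add_zero]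
  rw [re_logDeriv_riemannXi_eq_zero hs]
  exact hRH.re_logDeriv_riemannXi_nonneg (by simp; linarith)

/-! ### The Gamma factor on the critical line and the contradiction -/

open Complex Metric in
lemma exists_forall_norm_deriv_logDeriv_mul_Gammaℝ_le (K : ℝ) : ∃ T : ℝ, ∀ s : ℂ, s.re = 1 / 2 →
    T ≤ s.im → K ≤ (logDeriv (fun z ↦ z * (z - 1) * Gammaℝ z) s).re ∧
      DifferentiableAt ℂ (logDeriv (fun z ↦ z * (z - 1) * Gammaℝ z)) s ∧
      ‖deriv (logDeriv (fun z ↦ z * (z - 1) * Gammaℝ z)) s‖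
        ≤ 16 * (logDeriv (fun z ↦ z * (z - 1) * Gammaℝ z) s).re := by
  obtain ⟨T, hT⟩ := exists_forall_le_re_logDeriv_mul_Gammaℝ (max K 1)
  refine ⟨max T 0 + 1, fun s hs ht ↦ ?_⟩
  have ht1 : T + 1 ≤ s.im := by linarith [le_max_left T 0]
  have ht2 : 1 ≤ s.im := by linarith [le_max_right T 0]
  -- On this disc `Re P'/P ≥ 1`, so the derivative bound `4 A / (1/4)` gives the constant 16.
  have hball : ∀ z ∈ ball s (1 / 4), 0 < z.re ∧ T ≤ z.im ∧ 0 < z.im := by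
    intro z hz
    rw [mem_ball, dist_eq_norm] at hz
    have h1 := abs_lt.1 ((abs_re_le_norm (z - s)).trans_lt hz)
    have h2 := abs_lt.1 ((abs_im_le_norm (z - s)).trans_lt hz)
    rw [sub_re, hs] at h1
    rw [sub_im] at h2
    refine ⟨?_, ?_, ?_⟩ <;> linarith [h1.1, h1.2, h2.1, h2.2]
  have hd : DifferentiableOn ℂ (fun z ↦ z * (z - 1) * Gammaℝ z) (ball s (1 / 4)) := fun z hz ↦ by
    have := differentiableAt_Gammaℝ (hball z hz).1
    have : DifferentiableAt ℂ (fun z ↦ z * (z - 1) * Gammaℝ z) z := by fun_prop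
    exact this.differentiableWithinAt
  have hne : ∀ z ∈ ball s (1 / 4), z * (z - 1) * Gammaℝ z ≠ 0 := by
    intro z hz
    obtain ⟨h1, -, h3⟩ := hball z hz
    refine mul_ne_zero (mul_ne_zero ?_ (sub_ne_zero.2 ?_)) (Gammaℝ_ne_zero_of_re_pos h1) <;>
    · rintro rfl
      simp at h3
  have hD : DifferentiableOn ℂ (logDeriv (fun z ↦ z * (z - 1) * Gammaℝ z)) (ball s (1 / 4)) :=
    (hd.deriv isOpen_ball).div hd hne
  have hs4 : s ∈ ball s (1 / 4) := mem_ball_self (by norm_num)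
  have hK := hT s (hball s hs4).1 (hball s hs4).2.1
  refine ⟨(le_max_left _ _).trans hK, hD.differentiableAt (isOpen_ball.mem_nhds hs4), ?_⟩
  refine (norm_deriv_le_of_re_nonneg (by norm_num) hD (fun z hz ↦ ?_) ?_).trans (le_of_eq ?_)
  · linarith [hT z (hball z hz).1 (hball z hz).2.1, le_max_right K 1]
  · linarith [le_max_right K 1]
  · ring

/-- In general `(ζ'/ζ)' = ζ''/ζ - (ζ'/ζ)²`. -/
lemma hasDerivAt_logDeriv_riemannZeta_of_iteratedDeriv_two_eq_zero {s : ℂ} (h1 : s ≠ 1)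
    (hz : riemannZeta s ≠ 0) (h2 : iteratedDeriv 2 riemannZeta s = 0) :
    HasDerivAt (logDeriv riemannZeta) (-(logDeriv riemannZeta s) ^ 2) s := by
  rw [iteratedDeriv_succ, iteratedDeriv_one] at h2
  have hd : DifferentiableOn ℂ riemannZeta {1}ᶜ := fun z hz ↦
    (differentiableAt_riemannZeta hz).differentiableWithinAt
  have hd2 := ((hd.deriv isOpen_compl_singleton).differentiableAt
    (isOpen_compl_singleton.mem_nhds h1)).hasDerivAt
  rw [h2] at hd2
  convert! hd2.div (differentiableAt_riemannZeta h1).hasDerivAt hz using 1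
  rw [logDeriv_apply]
  field_simp
  ring

theorem corollary4 (hRH : RiemannHypothesis) :
    ∃ T : ℝ, ∀ γ' γ'' : ℝ, AreNeighboringOrdinates γ' γ'' →
      ∀ t : ℝ, T < t → γ' < t → t < γ'' →
        iteratedDeriv 2 riemannZeta (1 / 2 + Complex.I * (t : ℂ)) ≠ 0 := by
  -- Any bound above `8 + 8√2`, the positive root of `A² = 16 A + 64`, would do.
  obtain ⟨T, hT⟩ := exists_forall_norm_deriv_logDeriv_mul_Gammaℝ_le 21
  refine ⟨T, fun γ' γ'' hγ t ht h1 h2 h3 ↦ ?_⟩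
  have hz := hγ.2.2.2.2 t h1 h2
  have ht0 : 0 < t := hγ.1.trans h1
  set s : ℂ := 1 / 2 + Complex.I * t with hs
  have hre : s.re = 1 / 2 := by simp [hs]
  have him : s.im = t := by simp [hs]
  have hpos : 0 < s.re := by rw [hre]; norm_num
  have hs1 : s ≠ 1 := fun h ↦ by rw [h] at hre; norm_num at hre
  have hs0 : s ≠ 0 := fun h ↦ by rw [h] at hre; norm_num at hre
  obtain ⟨hA, hPd, hP⟩ := hT s hre (by linarith)
  have hξ : riemannXi s ≠ 0 := by
    rw [riemannXi_eq_Gammaℝ_mul hpos hs1]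
    exact mul_ne_zero (mul_ne_zero (mul_ne_zero hs0 (sub_ne_zero.2 hs1))
      (Complex.Gammaℝ_ne_zero_of_re_pos hpos)) hz
  have hL := hasDerivAt_logDeriv_riemannZeta_of_iteratedDeriv_two_eq_zero hs1 hz h3
  have heq : logDeriv riemannXi =ᶠ[nhds s]
      logDeriv (fun z ↦ z * (z - 1) * Complex.Gammaℝ z) + logDeriv riemannZeta := by
    filter_upwards [(isOpen_lt continuous_const Complex.continuous_re).mem_nhds hpos,
      isOpen_ne.mem_nhds hs1,
      (differentiableAt_riemannZeta hs1).continuousAt.eventually_ne hz] with z hz1 hz2 hz3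
    exact logDeriv_riemannXi hz1 hz2 hz3
  have hD := heq.deriv_eq.trans (hPd.hasDerivAt.add hL).deriv
  have hre0 := re_logDeriv_riemannXi_eq_zero hre
  have him0 := im_deriv_logDeriv_riemannXi_eq_zero hre hξ
  have hnn := hRH.re_deriv_logDeriv_riemannXi_nonneg hre hξ
  rw [heq.eq_of_nhds, Pi.add_apply, Complex.add_re] at hre0
  rw [hD, Complex.add_im, Complex.neg_im, sq, Complex.mul_im] at him0
  rw [hD, Complex.add_re, Complex.neg_re, sq, Complex.mul_re] at hnn
  set A := (logDeriv (fun z ↦ z * (z - 1) * Complex.Gammaℝ z) s).re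
  set p := deriv (logDeriv (fun z ↦ z * (z - 1) * Complex.Gammaℝ z)) s
  set B := (logDeriv riemannZeta s).im
  have hB : (logDeriv riemannZeta s).re = -A := by linarith
  rw [hB] at him0 hnn
  have hpre := abs_le.1 ((Complex.abs_re_le_norm p).trans hP)
  have hpim := abs_le.1 ((Complex.abs_im_le_norm p).trans hP)
  -- `him0` reads `Im p + 2AB = 0`, with `|Im p| ≤ 16 A` and `A > 0`.
  have hB1 : B ≤ 8 := by
    by_contra! h
    nlinarith [hpim.1]
  have hB2 : -8 ≤ B := by
    by_contra! h
    nlinarith [hpim.2]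
  nlinarith [hpre.2]
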